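/- Let $P_U>0$, $P_J\ge 0$, $\sigma^2>0$. Consider the Gaussian joint source-channel communication system with a jammer: the source is i.i.d. $S_i\sim\mathcal N(0,1)$, the channel is memoryless with $Y_i\sim\mathcal N(X_i+J_i,\sigma^2)$ given $(X_i,J_i)$, the distortion is $d(s,\hat s)=(s-\hat s)^2$, the user cost is $\rho_X(x)=x^2$ and the jammer cost is $\rho_{J|X}(j|x)=j^2$. For a block length $n\ge1$, the user chooses a (possibly randomized, possibly with encoder-decoder common randomness that the jammer does not see) encoder $f:S^n\mapsto X^n$ with $\mathbb E\sum_i X_i^2\le nP_U$ and a decoder $g:Y^n\mapsto\hat S^n$. The jammer chooses a (possibly randomized) map $\bar\lambda: X^n\mapsto J^n$ of the whole channel input block, with $\mathbb E\sum_i J_i^2\le nP_J$. The user minimizes and the jammer maximizes $D(f,\bar\lambda,g)=\frac1n\,\mathbb E\sum_{i=1}^n (S_i-\hat S_i)^2\in[0,\infty]$. A triple $(f^*,\bar\lambda^*,g^*)$ is a Nash equilibrium if $(f^*,g^*)$ satisfies the user constraint, $\bar\lambda^*$ satisfies the jammer constraint against every feasible code, and $D(f^*,\bar\lambda,g^*)\le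 D(f^*,\bar\lambda^*,g^*)\le D(f,\bar\lambda^*,g)$ for every jammer $\bar\lambda$ that satisfies its constraint against $f^*$ and every feasible code $(f,g)$. Then this system is matched: there are single-letter laws $p_{X|S}$, $p_{\hat S|Y}$, $p_{J|X}$ such that, for every $n\ge1$, uncoded communication with $(p_{X|S},p_{\hat S|Y})$ and i.i.d. jamming with $p_{J|X}$ form a Nash equilibrium. More precisely, let $(\alpha,\sigma_R^2)$ be Başar's parameters, that is, * if $P_J\ge P_U$: $\alpha=-1$ and $\sigma_R^2\in[0,P_J-P_U]$ arbitrary; * if $P_J<P_U$ and $(P_J+\sigma^2)^2\le P_UP_J$: $\alpha=-\frac{P_J+\sigma^2}{P_U}$ and $\sigma_R^2=P_J-\frac{(P_J+\sigma^2)^2}{P_U}$; * if $P_J<P_U$ and $(P_J+\sigma^2)^2> P_UP_J$: $\alpha=-\sqrt{P_J/P_U}$ and $\sigma_R^2=0$. Then for every $n\ge1$ the letter-by-letter encoder $f(S)=\sqrt{P_U}\,S$, the letter-by-letter Bayes decoder $$g(Y)=\frac{(1+\alpha)\sqrt{P_U}}{(1+\alpha)^2P_U+\sigma_R^2+\sigma^2}\,Y$$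 and the i.i.d. linear Gaussian jamming $J_i=\alpha X_i+R_i$, with $R_i\sim\mathcal N(0,\sigma_R^2)$ i.i.d. and independent of $X^n$, form a Nash equilibrium. -/

import Mathlib

open MeasureTheory ProbabilityTheory
open scoped NNReal ENNReal

namespace JSCCSJ

/-- A joint source-channel communication system with a jammer: source law, memoryless channel
`W(· | x, j)`, user cost `ρ_X(x)`, jammer cost `ρ_{J|X}(j | x)` and distortion `d(s, ŝ)`.
Costs and distortions are nonnegative, so that every expectation below is an unconditionally
meaningful element of `[0, ∞]`. -/
structure System (S X J Y T : Type*) [MeasurableSpace S] [MeasurableSpace X]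
    [MeasurableSpace J] [MeasurableSpace Y] [MeasurableSpace T] where
  source : Measure S
  source_prob : IsProbabilityMeasure source
  channel : Kernel (X × J) Y
  channel_markov : IsMarkovKernel channel
  userCost : X → ℝ≥0∞
  userCost_measurable : Measurable userCost
  jammerCost : J → X → ℝ≥0∞
  jammerCost_measurable : Measurable (Function.uncurry jammerCost)
  distortion : S → T → ℝ≥0∞
  distortion_measurable : Measurable (Function.uncurry distortion)

/-- The memoryless (letter by letter, independent) extension of a Markov kernel to blocks of
length `n`: the law of the output block given the input block `a` is `⨂ᵢ W(· | aᵢ)`. -/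
noncomputable def memoryless {A B : Type*} [MeasurableSpace A] [MeasurableSpace B] (n : ℕ)
    (W : Kernel A B) [IsMarkovKernel W] : Kernel (Fin n → A) (Fin n → B) where
  toFun a := Measure.pi fun i => W (a i)
  measurable' := by
    refine Measurable.measure_of_isPiSystem_of_isProbabilityMeasure
      generateFrom_pi.symm isPiSystem_pi ?_
    rintro _ ⟨s, hs, rfl⟩
    simp only [Set.mem_pi, Set.mem_univ, true_implies, Set.mem_ofPred_eq] at hs
    simp only [Measure.pi_pi]
    exact Finset.measurable_prod _ fun i _ =>
      (W.measurable_coe (hs i)).comp (measurable_pi_apply i)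

theorem memoryless_apply {A B : Type*} [MeasurableSpace A] [MeasurableSpace B] (n : ℕ)
    (W : Kernel A B) [IsMarkovKernel W] (a : Fin n → A) :
    memoryless n W a = Measure.pi fun i => W (a i) := rfl

instance memoryless_isMarkovKernel {A B : Type*} [MeasurableSpace A] [MeasurableSpace B] (n : ℕ)
    (W : Kernel A B) [IsMarkovKernel W] : IsMarkovKernel (memoryless n W) :=
  ⟨fun a => by rw [memoryless_apply]; infer_instance⟩

/-- A (possibly probabilistic) unit-rate block code of length `n`. Encoder and decoder may each
randomize privately, and may moreover share a random seed, which is independent of the source and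
of the channel and is not seen by the jammer. A code without common randomness ignores the
seed; deterministic codes are given by deterministic kernels. -/
structure Code (S X Y T : Type*) [MeasurableSpace S] [MeasurableSpace X]
    [MeasurableSpace Y] [MeasurableSpace T] (n : ℕ) where
  seed : Measure ℝ
  seed_prob : IsProbabilityMeasure seed
  enc : Kernel (ℝ × (Fin n → S)) (Fin n → X)
  enc_markov : IsMarkovKernel enc
  dec : Kernel (ℝ × (Fin n → Y)) (Fin n → T)
  dec_markov : IsMarkovKernel dec

/-- A (possibly probabilistic) jammer of block length `n`: it observes the whole channel input
block noncausally and chooses a random jamming block. -/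
structure Jammer (X J : Type*) [MeasurableSpace X] [MeasurableSpace J] (n : ℕ) where
  jam : Kernel (Fin n → X) (Fin n → J)
  jam_markov : IsMarkovKernel jam

/-- The uncoded (single-letter) communication strategy `(p_{X|S}, p_{Ŝ|Y})` on blocks of
length `n`; it makes no use of the seed. -/
noncomputable def uncoded {S X Y T : Type*} [MeasurableSpace S] [MeasurableSpace X]
    [MeasurableSpace Y] [MeasurableSpace T] (n : ℕ) (e : Kernel S X) [IsMarkovKernel e]
    (g : Kernel Y T) [IsMarkovKernel g] : Code S X Y T n where
  seed := Measure.dirac 0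
  seed_prob := inferInstance
  enc := (memoryless n e).comap Prod.snd measurable_snd
  enc_markov := inferInstance
  dec := (memoryless n g).comap Prod.snd measurable_snd
  dec_markov := inferInstance

/-- I.i.d. jamming with the single-letter law `p_{J|X}`. -/
noncomputable def iidJammer {X J : Type*} [MeasurableSpace X] [MeasurableSpace J] (n : ℕ)
    (l : Kernel X J) [IsMarkovKernel l] : Jammer X J n where
  jam := memoryless n l
  jam_markov := inferInstance

section Game

variable {S X J Y T : Type*} [MeasurableSpace S] [MeasurableSpace X]
    [MeasurableSpace J] [MeasurableSpace Y] [MeasurableSpace T]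

/-- Expected total transmit cost `E[∑ᵢ ρ_X(Xᵢ)]` of a code. -/
noncomputable def System.expectedUserCost (Γ : System S X J Y T) {n : ℕ} (C : Code S X Y T n) :
    ℝ≥0∞ :=
  haveI := Γ.source_prob
  ∫⁻ θ, ∫⁻ s, ∫⁻ x, ∑ i, Γ.userCost (x i)
    ∂(C.enc (θ, s)) ∂(Measure.pi fun _ : Fin n => Γ.source) ∂C.seed

/-- Expected total jamming cost `E[∑ᵢ ρ_{J|X}(Jᵢ | Xᵢ)]` of a jammer facing a given code. -/
noncomputable def System.expectedJammerCost (Γ : System S X J Y T) {n : ℕ}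
    (C : Code S X Y T n) (L : Jammer X J n) : ℝ≥0∞ :=
  haveI := Γ.source_prob
  ∫⁻ θ, ∫⁻ s, ∫⁻ x, ∫⁻ j, ∑ i, Γ.jammerCost (j i) (x i)
    ∂(L.jam x) ∂(C.enc (θ, s)) ∂(Measure.pi fun _ : Fin n => Γ.source) ∂C.seed

/-- Expected per-letter distortion `D(f, λ, g) = (1/n) E[∑ᵢ d(Sᵢ, Ŝᵢ)]`, where
`Sⁿ → Xⁿ → (Xⁿ, Jⁿ) → Yⁿ → Ŝⁿ` are generated by source, encoder, jammer, memoryless channel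
and decoder. -/
noncomputable def System.averageDistortion (Γ : System S X J Y T) {n : ℕ}
    (C : Code S X Y T n) (L : Jammer X J n) : ℝ≥0∞ :=
  haveI := Γ.source_prob
  haveI := Γ.channel_markov
  (n : ℝ≥0∞)⁻¹ *
    ∫⁻ θ, ∫⁻ s, ∫⁻ x, ∫⁻ j, ∫⁻ y, ∫⁻ t, ∑ i, Γ.distortion (s i) (t i)
      ∂(C.dec (θ, y)) ∂(memoryless n Γ.channel fun i => (x i, j i))
      ∂(L.jam x) ∂(C.enc (θ, s)) ∂(Measure.pi fun _ : Fin n => Γ.source) ∂C.seed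

/-- The user's average cost constraint. -/
def System.CodeFeasible (Γ : System S X J Y T) (PU : ℝ≥0) {n : ℕ} (C : Code S X Y T n) : Prop :=
  Γ.expectedUserCost C ≤ n * PU

/-- The jammer's average cost constraint, against a given code. -/
def System.JammerFeasible (Γ : System S X J Y T) (PJ : ℝ≥0) {n : ℕ}
    (C : Code S X Y T n) (L : Jammer X J n) : Prop :=
  Γ.expectedJammerCost C L ≤ n * PJ

/-- `(C, L)` is a Nash equilibrium of the zero-sum game of block length `n`, in which the user
minimizes and the jammer maximizes the average distortion. The equilibrium jammer has to
be feasible against every feasible code, whereas it has to do at least as well as every jammer that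
is feasible against the equilibrium code. -/
structure System.IsNash (Γ : System S X J Y T) (PU PJ : ℝ≥0) {n : ℕ}
    (C : Code S X Y T n) (L : Jammer X J n) : Prop where
  code_feasible : Γ.CodeFeasible PU C
  jammer_feasible : ∀ C' : Code S X Y T n, Γ.CodeFeasible PU C' → Γ.JammerFeasible PJ C' L
  jammer_optimal : ∀ L' : Jammer X J n, Γ.JammerFeasible PJ C L' →
    Γ.averageDistortion C L' ≤ Γ.averageDistortion C L
  code_optimal : ∀ C' : Code S X Y T n, Γ.CodeFeasible PU C' →
    Γ.averageDistortion C L ≤ Γ.averageDistortion C' L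

/-- A matched source-jammer-channel system: for some single-letter laws, uncoded communication
and i.i.d. jamming form a Nash equilibrium, at every block length. -/
def System.IsMatched (Γ : System S X J Y T) (PU PJ : ℝ≥0) : Prop :=
  ∃ (e : Kernel S X) (_ : IsMarkovKernel e) (g : Kernel Y T) (_ : IsMarkovKernel g)
    (l : Kernel X J) (_ : IsMarkovKernel l),
    ∀ n : ℕ, 0 < n → Γ.IsNash PU PJ (uncoded n e g) (iidJammer n l)

end Game

/-- The Markov kernel `x ↦ N(h(x), v)`. -/
noncomputable def gaussianKernel {A : Type*} [MeasurableSpace A] (h : A → ℝ) (hh : Measurable h)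
    (v : ℝ≥0) : Kernel A ℝ where
  toFun a := gaussianReal (h a) v
  measurable' := measurable_gaussianReal.comp (hh.prodMk measurable_const)

instance gaussianKernel_isMarkovKernel {A : Type*} [MeasurableSpace A] (h : A → ℝ)
    (hh : Measurable h) (v : ℝ≥0) : IsMarkovKernel (gaussianKernel h hh v) :=
  ⟨fun a => inferInstanceAs (IsProbabilityMeasure (gaussianReal (h a) v))⟩

/-- Standard Gaussian source, channel `Y ~ N(X + J, N)`, quadratic costs, squared error. -/
noncomputable def gaussianSystem (N : ℝ≥0) : System ℝ ℝ ℝ ℝ ℝ where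
  source := gaussianReal 0 1
  source_prob := inferInstance
  channel := gaussianKernel (fun p : ℝ × ℝ => p.1 + p.2) (by fun_prop) N
  channel_markov := inferInstance
  userCost x := ENNReal.ofReal (x ^ 2)
  userCost_measurable := by fun_prop
  jammerCost j _ := ENNReal.ofReal (j ^ 2)
  jammerCost_measurable := by unfold Function.uncurry; fun_prop
  distortion s t := ENNReal.ofReal ((s - t) ^ 2)
  distortion_measurable := by unfold Function.uncurry; fun_prop

/-- The deterministic single-letter map `z ↦ a z`. -/
noncomputable def linearKernel (a : ℝ) : Kernel ℝ ℝ :=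
  Kernel.deterministic (fun z => a * z) (by fun_prop)

instance linearKernel_isMarkovKernel (a : ℝ) : IsMarkovKernel (linearKernel a) :=
  inferInstanceAs (IsMarkovKernel (Kernel.deterministic (fun z => a * z) _))

/-- Linear Gaussian jamming `J = α X + R`, with `R ~ N(0, v)` independent of `X`. -/
noncomputable def linearGaussianJamming (α : ℝ) (v : ℝ≥0) : Kernel ℝ ℝ :=
  gaussianKernel (fun x => α * x) (by fun_prop) v

instance linearGaussianJamming_isMarkovKernel (α : ℝ) (v : ℝ≥0) :
    IsMarkovKernel (linearGaussianJamming α v) :=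
  inferInstanceAs (IsMarkovKernel (gaussianKernel _ _ v))

/-- Başar's parameters `(α, v)` of the linear Gaussian jammer `J = α X + R`, `R ~ N(0, v)`, for user
power `PU`, jammer power `PJ` and channel noise variance `N`, in the three regions of the
parameter space. When `PU ≤ PJ` the jammer cancels the signal, and is free to spend any part
of its remaining power on noise. -/
def IsBasarParameters (PU PJ N : ℝ≥0) (α : ℝ) (v : ℝ≥0) : Prop :=
  (PU ≤ PJ ∧ α = -1 ∧ PU + v ≤ PJ) ∨
  (PJ < PU ∧ (PJ + N) ^ 2 ≤ PU * PJ ∧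
    α = -((PJ + N : ℝ) / PU) ∧ (v : ℝ) = PJ - (PJ + N : ℝ) ^ 2 / PU) ∨
  (PJ < PU ∧ PU * PJ < (PJ + N) ^ 2 ∧ α = -√((PJ : ℝ) / PU) ∧ v = 0)

/-- The gain `E[S Y] / E[Y²]` of the Bayes (minimum mean-square error) estimator of
`S ~ N(0, 1)` from `Y = X + J + Z`, where `X = √PU S`, `J = α X + R`, `R ~ N(0, v)` and
`Z ~ N(0, N)`. -/
noncomputable def bayesGain (PU N : ℝ≥0) (α : ℝ) (v : ℝ≥0) : ℝ :=
  (1 + α) * √(PU : ℝ) / ((1 + α) ^ 2 * PU + v + N)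

end JSCCSJ

/-! Put V = (v + N) / ((1 + α)² PU + v + N). Both equilibrium inequalities follow from two bounds
with the same value V, at every block length: a jammer feasible against the uncoded strategy causes
distortion at most V, and a feasible code against the linear Gaussian jammer suffers at least V.

Upper bound: for linear encoding and decoding the mean error given (s, j) is a sum over letters of a
quadratic form in (sᵢ, jᵢ), plus a constant noise term. `IsBasarParameters.exists_weights` dominates
that form by A s² + B j², without a cross term. Only the total jamming energy then matters, so
nothing is gained by jamming the block jointly (`averageDistortion_uncoded_le`).

Lower bound: jammer and channel compose to the memoryless channel Y = (1 + α) X + N(0, v + N)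
(`lintegral_channel_jammer`). Its converse, `le_lintegral_distortion`, needs no mutual information.
For a Gaussian output law Q and a Gaussian backward test channel, the product of likelihood ratios
exp(u) = (dQ/dW)(y | x) · (dN(t, M/T)/dN(0, 1))(s) has mean 1 for every code
(`lintegral_jointLaw_exp`). Integrating 1 + u ≤ exp(u) gives E u ≤ 0, which is a linear inequality
between second moments. It is tight for the equilibrium code, where u = 0 by Bayes' rule. -/

namespace JSCCSJ

/-! ### Product measures -/

section Pi

variable {ι : Type*} [Fintype ι] {A : ι → Type*} [∀ i, MeasurableSpace (A i)]

theorem lintegral_pi_prod (μ : ∀ i, Measure (A i)) [∀ i, IsProbabilityMeasure (μ i)]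
    {f : ∀ i, A i → ℝ≥0∞} (hf : ∀ i, Measurable (f i)) :
    ∫⁻ y, ∏ i, f i (y i) ∂Measure.pi μ = ∏ i, ∫⁻ a, f i a ∂μ i := by
  have h := iIndepFun_pi (μ := μ) (X := f) fun i => (hf i).aemeasurable
  rw [lintegral_prod_eq_prod_lintegral_of_indepFun Finset.univ _ h
    fun i => (hf i).comp (measurable_pi_apply i)]
  exact Finset.prod_congr rfl fun i _ => (measurePreserving_eval μ i).lintegral_comp (hf i)

theorem lintegral_pi_sum (μ : ∀ i, Measure (A i)) [∀ i, IsProbabilityMeasure (μ i)]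
    {f : ∀ i, A i → ℝ≥0∞} (hf : ∀ i, Measurable (f i)) :
    ∫⁻ y, ∑ i, f i (y i) ∂Measure.pi μ = ∑ i, ∫⁻ a, f i a ∂μ i := by
  rw [lintegral_finsetSum (f := fun (i : ι) (y : ∀ i, A i) => f i (y i)) _
    fun i _ => (hf i).comp (measurable_pi_apply i)]
  exact Finset.sum_congr rfl fun i _ => (measurePreserving_eval μ i).lintegral_comp (hf i)

/-- Tensorizes unnormalized tilts; it carries the one-letter change of measure of
`gaussianReal_withDensity_exp` to blocks. -/
theorem pi_withDensity_eq_smul {μ ν : ∀ i, Measure (A i)} [∀ i, IsProbabilityMeasure (μ i)]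
    [∀ i, IsProbabilityMeasure (ν i)] {f : ∀ i, A i → ℝ≥0∞} (hf : ∀ i, Measurable (f i))
    {c : ι → ℝ≥0} (h : ∀ i, (μ i).withDensity (f i) = c i • ν i) :
    (Measure.pi μ).withDensity (fun y => ∏ i, f i (y i)) = (∏ i, c i) • Measure.pi ν := by
  have key : ∀ s : ∀ i, Set (A i), (∀ i, MeasurableSet (s i)) →
      (Measure.pi μ).withDensity (fun y => ∏ i, f i (y i)) (Set.univ.pi s) =
        ∏ i, (c i • ν i) (s i) := by
    intro s hs
    rw [withDensity_apply _ (MeasurableSet.univ_pi hs),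
      ← lintegral_indicator (MeasurableSet.univ_pi hs)]
    have h1 : ∀ i, (c i • ν i) (s i) = ∫⁻ a, (s i).indicator (f i) a ∂μ i := fun i => by
      rw [← h i, withDensity_apply _ (hs i), lintegral_indicator (hs i)]
    simp_rw [h1]
    rw [← lintegral_pi_prod μ fun i => (hf i).indicator (hs i)]
    congr 1 with y
    -- The indicator of a box is the product of the coordinate indicators.
    classical
    simp only [Set.indicator_apply, Set.mem_univ_pi]
    split_ifs with h
    · exact Finset.prod_congr rfl fun i _ => (if_pos (h i)).symm
    · push Not at h
      obtain ⟨i, hi⟩ := h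
      exact (Finset.prod_eq_zero (Finset.mem_univ i) (if_neg hi)).symm
  rw [← Measure.pi_eq key]
  refine Measure.pi_eq fun s hs => ?_
  simp only [Measure.smul_apply, ENNReal.smul_def, smul_eq_mul]
  rw [Finset.prod_mul_distrib, ENNReal.ofNNReal_finsetProd, Measure.pi_pi]

theorem pi_dirac (a : ∀ i, A i) :
    Measure.pi (fun i => Measure.dirac (a i)) = Measure.dirac a := by
  refine Measure.pi_eq fun s hs => ?_
  classical
  simp only [Measure.dirac_apply' _ (MeasurableSet.univ_pi hs),
    fun i => Measure.dirac_apply' (a i) (hs i), Set.indicator_apply, Set.mem_univ_pi, Pi.one_apply]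
  split_ifs with h
  · exact (Finset.prod_eq_one fun i _ => if_pos (h i)).symm
  · push Not at h
    obtain ⟨i, hi⟩ := h
    exact (Finset.prod_eq_zero (Finset.mem_univ i) (if_neg hi)).symm

end Pi

/-! ### Gaussian laws: composition, second moments, tilting -/

/-- Integrating a Gaussian over an independent Gaussian mean is convolution, so means and variances
add. -/
theorem bind_gaussianReal (m b : ℝ) (v w : ℝ≥0) :
    (gaussianReal m v).bind (gaussianKernel (fun j : ℝ => b + j) (by fun_prop) w) =
      gaussianReal (b + m) (v + w) := by
  have h : gaussianReal (b + m) (v + w) = gaussianReal m v ∗ gaussianReal b w := by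
    rw [gaussianReal_conv_gaussianReal, add_comm b m]
  ext s hs
  rw [h, Measure.bind_apply hs (Kernel.aemeasurable _), ← lintegral_indicator_one hs,
    Measure.lintegral_conv (by fun_prop (disch := assumption))]
  congr 1 with j
  change gaussianReal (b + j) w s = _
  rw [← gaussianReal_map_const_add j, Measure.map_apply (by fun_prop) hs,
    ← lintegral_indicator_one (measurableSet_preimage (by fun_prop) hs)]
  rfl

theorem bind_pi {A B : Type*} [MeasurableSpace A] [MeasurableSpace B] {n : ℕ}
    (μ : Fin n → Measure A) [∀ i, IsProbabilityMeasure (μ i)]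
    (κ : Fin n → Kernel A B) [∀ i, IsMarkovKernel (κ i)]
    (K : Kernel (Fin n → A) (Fin n → B)) (hK : ∀ a, K a = Measure.pi fun i => κ i (a i)) :
    (Measure.pi μ).bind K = Measure.pi fun i => (μ i).bind (κ i) := by
  have : ∀ i, IsProbabilityMeasure ((μ i).bind (κ i)) := fun i => inferInstance
  refine (Measure.pi_eq fun s hs => ?_).symm
  rw [Measure.bind_apply (MeasurableSet.univ_pi hs) (Kernel.aemeasurable _)]
  simp_rw [hK, Measure.pi_pi,
    fun i => Measure.bind_apply (m := μ i) (hs i) (Kernel.aemeasurable (κ i))]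
  exact lintegral_pi_prod μ fun i => (κ i).measurable_coe (hs i)

theorem lintegral_gaussianReal_sq (m a c : ℝ) (v : ℝ≥0) :
    ∫⁻ y, ENNReal.ofReal ((a + c * y) ^ 2) ∂gaussianReal m v =
      ENNReal.ofReal ((a + c * m) ^ 2 + c ^ 2 * v) := by
  have hL : MemLp (fun y : ℝ => a + c * y) 2 (gaussianReal m v) :=
    (memLp_const a).add ((memLp_id_gaussianReal 2).const_mul c)
  rw [← ofReal_integral_eq_lintegral_ofReal hL.integrable_sq
    (Filter.Eventually.of_forall fun y => sq_nonneg _)]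
  congr 1
  have h := variance_eq_sub hL
  have hi : Integrable (fun y : ℝ => y) (gaussianReal m v) :=
    (memLp_id_gaussianReal 1).integrable le_rfl
  have h1 : ∫ y, (a + c * y) ∂gaussianReal m v = a + c * m := by
    rw [integral_add (integrable_const a) (hi.const_mul c), integral_const_mul]
    simp
  have h2 : Var[fun y : ℝ => a + c * y; gaussianReal m v] = c ^ 2 * v := by
    rw [variance_const_add (by fun_prop), variance_const_mul, variance_fun_id_gaussianReal]
  rw [h1, h2] at h
  simp only [Pi.pow_apply] at h
  linarith

/-- Completing the square: tilting `N(m, v)` by `exp((y-m)²/(2v) - (y-b)²/(2w))` gives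
`√(w/v) N(b, w)`. -/
theorem gaussianReal_withDensity_exp (m b : ℝ) {v w : ℝ≥0} (hv : v ≠ 0) (hw : w ≠ 0) :
    (gaussianReal m v).withDensity
        (fun y => ENNReal.ofReal (Real.exp ((y - m) ^ 2 / (2 * v) - (y - b) ^ 2 / (2 * w)))) =
      NNReal.sqrt (w / v) • gaussianReal b w := by
  have hv' : (0 : ℝ) < v := by positivity
  have hw' : (0 : ℝ) < w := by positivity
  have hc : NNReal.sqrt (w / v) • gaussianReal b w =
      ENNReal.ofReal √(w / v) • gaussianReal b w := by
    rw [← NNReal.coe_div, ← Real.coe_sqrt, ENNReal.ofReal_coe_nnreal]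
    rfl
  rw [hc, gaussianReal_of_var_ne_zero _ hv, gaussianReal_of_var_ne_zero _ hw,
    ← withDensity_mul _ (measurable_gaussianPDF m v) (by fun_prop),
    ← withDensity_smul _ (measurable_gaussianPDF b w)]
  congr 1 with y
  simp only [Pi.mul_apply, Pi.smul_apply, smul_eq_mul, gaussianPDF, gaussianPDFReal]
  rw [← ENNReal.ofReal_mul (by positivity), ← ENNReal.ofReal_mul (by positivity)]
  congr 1
  rw [mul_assoc, ← Real.exp_add, ← mul_assoc, Real.sqrt_div hw'.le]
  have h1 := (Real.sqrt_pos.2 hv').ne'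
  have h2 := (Real.sqrt_pos.2 hw').ne'
  have h3 := (Real.sqrt_pos.2 (mul_pos two_pos Real.pi_pos)).ne'
  rw [Real.sqrt_mul (by positivity) (v : ℝ), Real.sqrt_mul (by positivity) (w : ℝ)]
  congr 1
  · field_simp
  · congr 1
    ring

/-! ### Başar's parameters -/

/-- Equality holds in the last two regions; only a jammer that cancels the signal may leave power
unused. -/
theorem IsBasarParameters.power_le {PU PJ N v : ℝ≥0} {α : ℝ} (hPU : 0 < PU)
    (h : IsBasarParameters PU PJ N α v) : α ^ 2 * PU + v ≤ (PJ : ℝ) := by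
  have hP : (0 : ℝ) < PU := hPU
  rcases h with ⟨-, rfl, h⟩ | ⟨-, -, rfl, hv⟩ | ⟨-, -, rfl, rfl⟩
  · have : ((PU + v : ℝ≥0) : ℝ) ≤ PJ := NNReal.coe_le_coe.2 h
    push_cast at this
    linarith
  · rw [hv]
    apply le_of_eq
    field_simp
    ring
  · rw [neg_sq, Real.sq_sqrt (by positivity)]
    apply le_of_eq
    field_simp
    simp

/-- A weighted Cauchy-Schwarz inequality bounds the distortion of the linear decoder by the source
and jamming energies, with weights that are tight at the equilibrium. -/
theorem IsBasarParameters.exists_weights {PU PJ N v : ℝ≥0} {α : ℝ} (hPU : 0 < PU) (hN : 0 < N)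
    (h : IsBasarParameters PU PJ N α v) {ε : ℝ} (hε : 0 < ε) :
    ∃ A B : ℝ, 0 ≤ A ∧ 0 ≤ B ∧
      (∀ s j : ℝ, (s - bayesGain PU N α v * (√(PU : ℝ) * s + j)) ^ 2 ≤ A * s ^ 2 + B * j ^ 2) ∧
      A + B * PJ + bayesGain PU N α v ^ 2 * N ≤ (v + N) / ((1 + α) ^ 2 * PU + v + N) + ε := by
  have hP : (0 : ℝ) < PU := hPU
  have hN' : (0 : ℝ) < N := hN
  have hJ : (0 : ℝ) ≤ PJ := PJ.2
  have hr : (0 : ℝ) < √(PU : ℝ) := Real.sqrt_pos.2 hP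
  have hr2 : √(PU : ℝ) ^ 2 = PU := Real.sq_sqrt hP.le
  rcases h with ⟨-, rfl, -⟩ | ⟨hlt, hle, hα, hv⟩ | ⟨hlt, hgt, hα, rfl⟩
  -- The signal is cancelled and the gain is 0: the decoder outputs 0 and the error is s.
  · refine ⟨1, 0, zero_le_one, le_rfl, fun s j => ?_, ?_⟩
    · simp [bayesGain]
    · have : (v + N : ℝ) ≠ 0 := by positivity
      simp [bayesGain, this, hε.le]
  · have hlt' : (PJ : ℝ) < PU := hlt
    have hle' : (PJ + N : ℝ) ^ 2 ≤ PU * PJ := by exact_mod_cast hle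
    -- Otherwise (PJ + N)² ≥ PU (PJ + N) > PU PJ. This gives 1 + α > 0 below.
    have h1 : (PJ + N : ℝ) < PU := by nlinarith
    have hαP : α * PU = -(PJ + N) := by rw [hα]; field_simp
    have ha : 0 < 1 + α := by
      have : 0 < (1 + α) * PU := by linarith
      exact pos_of_mul_pos_left this hP.le
    have hv' : (v : ℝ) + N = -α * PU * (1 + α) := by
      have : (v : ℝ) = PJ - α ^ 2 * PU := by rw [hv, hα]; field_simp
      rw [this]
      linear_combination hαP
    have hT : (1 + α) ^ 2 * PU + v + N = PU * (1 + α) := by linear_combination hv'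
    have hc : bayesGain PU N α v = 1 / √(PU : ℝ) := by
      rw [bayesGain, hT, ← hr2, Real.sqrt_sq hr.le]
      field_simp
    -- Here the gain inverts the encoder exactly, so the error no longer depends on s.
    refine ⟨0, 1 / PU, le_rfl, by positivity, fun s j => ?_, ?_⟩
    · rw [hc]
      apply le_of_eq
      have : s - 1 / √(PU : ℝ) * (√(PU : ℝ) * s + j) = -(1 / √(PU : ℝ) * j) := by
        field_simp
        ring
      rw [this, neg_sq, mul_pow, div_pow, hr2]
      ring
    · rw [hc, hT, hv', div_pow, hr2]
      have : -α * PU * (1 + α) / (PU * (1 + α)) = 1 / PU * PJ + 1 / PU * N := by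
        field_simp
        linear_combination -hαP
      rw [this]
      linarith
  · have hlt' : (PJ : ℝ) < PU := hlt
    have hgt' : (PU * PJ : ℝ) < (PJ + N) ^ 2 := by exact_mod_cast hgt
    set r := √(PU : ℝ)
    set q := √(PJ : ℝ)
    have hq0 : 0 ≤ q := Real.sqrt_nonneg _
    have hq2 : q ^ 2 = PJ := Real.sq_sqrt hJ
    have hqr : q < r := Real.sqrt_lt_sqrt hJ hlt'
    have hαr : (1 + α) * r = r - q := by
      rw [hα, Real.sqrt_div hJ]
      field_simp
      ring
    have hT : (1 + α) ^ 2 * PU + (0 : ℝ≥0) + N = (r - q) ^ 2 + N := by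
      rw [← hr2, ← mul_pow, hαr]
      simp
    have hT0 : 0 < (r - q) ^ 2 + (N : ℝ) := by positivity
    have hcd : bayesGain PU N α 0 = (r - q) / ((r - q) ^ 2 + N) := by
      rw [bayesGain, hT, hαr]
    rw [hT]
    set c := bayesGain PU N α 0
    have hc : 0 ≤ c := by rw [hcd]; exact div_nonneg (by linarith) hT0.le
    have hrq : r * q ≤ q ^ 2 + N := by
      refine abs_le_of_sq_le_sq' ?_ (by positivity) |>.2
      rw [mul_pow, hr2, hq2]
      exact hgt'.le
    -- This is equivalent to r q ≤ q² + N, hence to the inequality that bounds this region up to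
    -- strictness. It makes the Cauchy-Schwarz coefficient (1 - c r) c nonnegative.
    have hb : 0 ≤ 1 - c * r := by
      rw [hcd, div_mul_eq_mul_div, sub_nonneg, div_le_one hT0]
      nlinarith
    have hval : (1 - c * r + c * q) ^ 2 + c ^ 2 * N = (N : ℝ) / ((r - q) ^ 2 + N) := by
      rw [hcd]
      field_simp
      ring
    -- The cross term -2 (1 - c r) c s j is split with weight β. For (1 - c r) c > 0, equality means
    -- j = -β s, and the equilibrium jammer has j = -q s, so β = q is the right choice.
    have hpt : ∀ β : ℝ, 0 < β → ∀ s j : ℝ, (s - c * (r * s + j)) ^ 2 ≤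
        ((1 - c * r) ^ 2 + (1 - c * r) * c * β) * s ^ 2 + (c ^ 2 + (1 - c * r) * c / β) * j ^ 2 := by
      intro β hβ s j
      have h1 : 0 ≤ (1 - c * r) * c / β * (β * s + j) ^ 2 := by positivity
      have h2 : (1 - c * r) * c / β * (β * s + j) ^ 2 =
          (1 - c * r) * c * β * s ^ 2 + 2 * (1 - c * r) * c * s * j
            + (1 - c * r) * c / β * j ^ 2 := by
        field_simp
        ring
      linear_combination h1 + h2
    rcases hq0.eq_or_lt with hq | hq
    -- For PJ = 0 the ideal weight q is 0, which is not allowed; a small β costs at most ε. This is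
    -- why the statement carries ε.
    · have hβ : 0 < ε / ((1 - c * r) * c + 1) := by positivity
      refine ⟨_, _, by positivity, by positivity, hpt _ hβ, ?_⟩
      have hPJ : (PJ : ℝ) = 0 := by rw [← hq2, ← hq]; simp
      rw [NNReal.coe_zero, zero_add, ← hval, hPJ, ← hq]
      have : (1 - c * r) * c * (ε / ((1 - c * r) * c + 1)) ≤ ε := by
        rw [mul_div_assoc', div_le_iff₀ (by positivity)]
        nlinarith
      linear_combination this
    · refine ⟨_, _, by positivity, by positivity, hpt q hq, ?_⟩
      rw [NNReal.coe_zero, zero_add, ← hval, ← hq2]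
      have : (1 - c * r) * c / q * q ^ 2 = (1 - c * r) * c * q := by field_simp
      linear_combination this + hε.le

/-! ### The composite channel and change of measure for codes -/

theorem lintegral_channel_jammer {n : ℕ} (N v : ℝ≥0) (α : ℝ) (x : Fin n → ℝ)
    {G : (Fin n → ℝ) → ℝ≥0∞} (hG : Measurable G) :
    haveI := (gaussianSystem N).channel_markov
    ∫⁻ j, ∫⁻ y, G y ∂(memoryless n (gaussianSystem N).channel fun i => (x i, j i))
        ∂(memoryless n (linearGaussianJamming α v) x) =
      ∫⁻ y, G y ∂(memoryless n (linearGaussianJamming (1 + α) (v + N)) x) := by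
  have := (gaussianSystem N).channel_markov
  let K : Kernel (Fin n → ℝ) (Fin n → ℝ) :=
    (memoryless n (gaussianSystem N).channel).comap (fun j i => (x i, j i)) (by fun_prop)
  change ∫⁻ j, ∫⁻ y, G y ∂K j ∂(memoryless n (linearGaussianJamming α v) x) = _
  rw [← Measure.lintegral_bind (Kernel.aemeasurable _) hG.aemeasurable, memoryless_apply,
    memoryless_apply, bind_pi (fun i => linearGaussianJamming α v (x i))
      (fun i => gaussianKernel (fun j : ℝ => x i + j) (by fun_prop) N) K fun _ => rfl]
  congr 2 with i : 1
  refine (bind_gaussianReal (α * x i) (x i) v N).trans ?_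
  change _ = gaussianReal ((1 + α) * x i) (v + N)
  congr 1
  ring

/-- The joint law of `((((θ, s), x), y), t)`: seed, source, channel input, channel output,
reconstruction, when a code is used over the channel `W`. -/
noncomputable def jointLaw {n : ℕ} (C : Code ℝ ℝ ℝ ℝ n) (W : Kernel (Fin n → ℝ) (Fin n → ℝ)) :
    Measure ((((ℝ × (Fin n → ℝ)) × (Fin n → ℝ)) × (Fin n → ℝ)) × (Fin n → ℝ)) :=
  (((C.seed.prod (Measure.pi fun _ : Fin n => gaussianReal 0 1)) ⊗ₘ C.enc) ⊗ₘ
    W.comap Prod.snd measurable_snd) ⊗ₘ C.dec.comap (fun p => (p.1.1.1, p.2)) (by fun_prop)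

theorem lintegral_jointLaw {n : ℕ} (C : Code ℝ ℝ ℝ ℝ n) (W : Kernel (Fin n → ℝ) (Fin n → ℝ))
    [IsMarkovKernel W]
    {f : ((((ℝ × (Fin n → ℝ)) × (Fin n → ℝ)) × (Fin n → ℝ)) × (Fin n → ℝ)) → ℝ≥0∞}
    (hf : Measurable f) :
    ∫⁻ ω, f ω ∂jointLaw C W =
      ∫⁻ θ, ∫⁻ s, ∫⁻ x, ∫⁻ y, ∫⁻ t, f ((((θ, s), x), y), t) ∂(C.dec (θ, y)) ∂(W x)
        ∂(C.enc (θ, s)) ∂(Measure.pi fun _ : Fin n => gaussianReal 0 1) ∂C.seed := by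
  have := C.seed_prob
  have := C.enc_markov
  have := C.dec_markov
  unfold jointLaw
  have h1 := hf.lintegral_kernel_prod_right'
    (κ := C.dec.comap (fun p : ((ℝ × (Fin n → ℝ)) × (Fin n → ℝ)) × (Fin n → ℝ) =>
      (p.1.1.1, p.2)) (by fun_prop))
  have h2 := h1.lintegral_kernel_prod_right'
    (κ := W.comap (Prod.snd : (ℝ × (Fin n → ℝ)) × (Fin n → ℝ) → _) measurable_snd)
  rw [Measure.lintegral_compProd hf, Measure.lintegral_compProd h1, Measure.lintegral_compProd h2,
    lintegral_prod _ (h2.lintegral_kernel_prod_right' (κ := C.enc)).aemeasurable]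
  rfl

/-- Integrals against the output of a randomized map whose input does not depend on the source. -/
theorem lintegral_lintegral_kernel {S Y T : Type*} [MeasurableSpace S] [MeasurableSpace Y]
    [MeasurableSpace T] (p : Measure S) (Q : Measure Y) [SFinite p] [IsProbabilityMeasure Q]
    (κ : Kernel Y T) [IsMarkovKernel κ] {B : S → T → ℝ≥0∞} (hB : Measurable (Function.uncurry B))
    {l : ℝ≥0∞} (hl : ∀ t, ∫⁻ s, B s t ∂p = l) :
    ∫⁻ s, ∫⁻ y, ∫⁻ t, B s t ∂κ y ∂Q ∂p = l := by
  -- The law of t under Q and κ is the same for all s, so the order of s and t can be exchanged.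
  have h : ∀ s, ∫⁻ y, ∫⁻ t, B s t ∂κ y ∂Q = ∫⁻ t, B s t ∂(Q.bind κ) := fun s =>
    (Measure.lintegral_bind (Kernel.aemeasurable _) hB.of_uncurry_left.aemeasurable).symm
  simp_rw [h]
  rw [lintegral_lintegral_swap hB.aemeasurable]
  simp_rw [hl]
  rw [lintegral_const, measure_univ, mul_one]

/-- The Radon-Nikodym derivative of the forward channel law with respect to an output law times
that of the backward test channel with respect to the source has total mass one. -/
theorem lintegral_jointLaw_exp {n : ℕ} (C : Code ℝ ℝ ℝ ℝ n) (a : ℝ) {M T : ℝ≥0} (hM : M ≠ 0)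
    (hT : T ≠ 0) :
    ∫⁻ ω, (∏ i, ENNReal.ofReal (Real.exp
          ((ω.1.2 i - a * ω.1.1.2 i) ^ 2 / (2 * M) - (ω.1.2 i - 0) ^ 2 / (2 * T)))) *
        (∏ i, ENNReal.ofReal (Real.exp
          ((ω.1.1.1.2 i - 0) ^ 2 / (2 * (1 : ℝ≥0)) -
            (ω.1.1.1.2 i - ω.2 i) ^ 2 / (2 * (M / T : ℝ≥0)))))
      ∂jointLaw C (memoryless n (linearGaussianJamming a M)) = 1 := by
  have := C.seed_prob
  have := C.enc_markov
  have := C.dec_markov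
  rw [lintegral_jointLaw _ _ (by fun_prop)]
  dsimp only
  set Q : Measure (Fin n → ℝ) := Measure.pi fun _ => gaussianReal 0 T
  set p : Measure (Fin n → ℝ) := Measure.pi fun _ => gaussianReal 0 1
  set B : (Fin n → ℝ) → (Fin n → ℝ) → ℝ≥0∞ := fun s t => ∏ i, ENNReal.ofReal (Real.exp
    ((s i - 0) ^ 2 / (2 * (1 : ℝ≥0)) - (s i - t i) ^ 2 / (2 * (M / T : ℝ≥0))))
  have hBm : Measurable (Function.uncurry B) := by unfold B Function.uncurry; fun_prop
  set k : ℝ≥0 := ∏ _i : Fin n, NNReal.sqrt (T / M)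
  set l : ℝ≥0 := ∏ _i : Fin n, NNReal.sqrt ((M / T) / 1)
  -- The tilts have masses √(T/M) and √(M/T) per letter. The backward variance M/T is chosen so that
  -- they cancel.
  have hkl : (k : ℝ≥0∞) * l = 1 := by
    rw [← ENNReal.coe_mul, ← Finset.prod_mul_distrib, ← ENNReal.coe_one]
    congr 1
    refine Finset.prod_eq_one fun i _ => ?_
    rw [← NNReal.sqrt_mul]
    field_simp
    simp
  have hs : ∀ t, ∫⁻ s, B s t ∂p = l := fun t => by
    have h := pi_withDensity_eq_smul (μ := fun _ : Fin n => gaussianReal 0 1)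
      (ν := fun i => gaussianReal (t i) (M / T))
      (f := fun i s => ENNReal.ofReal (Real.exp
        ((s - 0) ^ 2 / (2 * (1 : ℝ≥0)) - (s - t i) ^ 2 / (2 * (M / T : ℝ≥0)))))
      (fun i => by fun_prop)
      (fun i => gaussianReal_withDensity_exp 0 (t i) one_ne_zero (div_ne_zero hM hT))
    have h2 := congrArg (fun μ : Measure (Fin n → ℝ) => μ Set.univ) h
    simp only [withDensity_apply _ MeasurableSet.univ, Measure.restrict_univ] at h2
    rw [h2]
    simp [l, ENNReal.smul_def]
  -- The first factor replaces the channel output law by k Q whatever x is, so y, and with it t,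
  -- becomes independent of the source given the seed.
  have hy : ∀ (θ : ℝ) (s x : Fin n → ℝ),
      ∫⁻ y, ∫⁻ t, (∏ i, ENNReal.ofReal (Real.exp
          ((y i - a * x i) ^ 2 / (2 * M) - (y i - 0) ^ 2 / (2 * T)))) * B s t
        ∂(C.dec (θ, y)) ∂(memoryless n (linearGaussianJamming a M) x) =
      k * ∫⁻ y, ∫⁻ t, B s t ∂(C.dec (θ, y)) ∂Q := fun θ s x => by
    have hBs : Measurable (B s) := hBm.of_uncurry_left
    have hH : Measurable fun y => ∫⁻ t, B s t ∂(C.dec (θ, y)) :=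
      hBs.lintegral_kernel.comp (by fun_prop)
    have h := pi_withDensity_eq_smul (μ := fun i => gaussianReal (a * x i) M)
      (ν := fun _ : Fin n => gaussianReal 0 T)
      (f := fun i y => ENNReal.ofReal (Real.exp
        ((y - a * x i) ^ 2 / (2 * M) - (y - 0) ^ 2 / (2 * T))))
      (fun i => by fun_prop)
      (fun i => gaussianReal_withDensity_exp (a * x i) 0 hM hT)
    have h2 := congrArg (fun μ : Measure (Fin n → ℝ) => ∫⁻ y, ∫⁻ t, B s t ∂(C.dec (θ, y)) ∂μ) h
    rw [lintegral_withDensity_eq_lintegral_mul _ (by fun_prop) hH] at h2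
    simp_rw [lintegral_const_mul _ hBs]
    refine h2.trans ?_
    rw [lintegral_smul_measure]
    rfl
  have hθ := fun θ : ℝ => lintegral_lintegral_kernel p Q
    (C.dec.comap (fun y : Fin n → ℝ => (θ, y)) (by fun_prop)) hBm hs
  refine (lintegral_congr fun θ => lintegral_congr fun s => lintegral_congr fun x =>
    hy θ s x).trans ?_
  simp only [lintegral_const, measure_univ, mul_one]
  calc _ = ∫⁻ _, (1 : ℝ≥0∞) ∂C.seed := lintegral_congr fun θ => by
        rw [lintegral_const_mul' _ _ ENNReal.coe_ne_top]
        exact (congrArg _ (hθ θ)).trans hkl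
    _ = 1 := by simp

instance jointLaw_isProbabilityMeasure {n : ℕ} (C : Code ℝ ℝ ℝ ℝ n)
    (W : Kernel (Fin n → ℝ) (Fin n → ℝ)) [IsMarkovKernel W] :
    IsProbabilityMeasure (jointLaw C W) := by
  have := C.seed_prob
  have := C.enc_markov
  have := C.dec_markov
  unfold jointLaw
  infer_instance

/-! ### Second moments of blocks -/

theorem lintegral_memoryless_gaussian_sq {A : Type*} [MeasurableSpace A] {n : ℕ} (h : A → ℝ)
    (hh : Measurable h) (v : ℝ≥0) (z : Fin n → A) (b : Fin n → ℝ) (c : ℝ) :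
    ∫⁻ y, ∑ i, ENNReal.ofReal ((b i + c * y i) ^ 2) ∂memoryless n (gaussianKernel h hh v) z =
      ∑ i, ENNReal.ofReal ((b i + c * h (z i)) ^ 2 + c ^ 2 * v) := by
  refine (lintegral_pi_sum (fun i => gaussianReal (h (z i)) v)
    (f := fun i y => ENNReal.ofReal ((b i + c * y) ^ 2)) fun i => by fun_prop).trans ?_
  exact Finset.sum_congr rfl fun i _ => lintegral_gaussianReal_sq _ _ _ _

theorem lintegral_source_sq (n : ℕ) :
    ∫⁻ s, ∑ i, ENNReal.ofReal (s i ^ 2) ∂(Measure.pi fun _ : Fin n => gaussianReal 0 1) = n := by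
  rw [lintegral_pi_sum (fun _ => gaussianReal 0 1) (f := fun _ s => ENNReal.ofReal (s ^ 2))
    fun i => by fun_prop]
  have h := lintegral_gaussianReal_sq 0 0 1 1
  simp only [zero_add, one_mul] at h
  simp [h]

theorem memoryless_linearKernel (n : ℕ) (a : ℝ) (s : Fin n → ℝ) :
    memoryless n (linearKernel a) s = Measure.dirac fun i => a * s i := by
  rw [memoryless_apply, ← pi_dirac]
  rfl

/-- The second moment of the output of a linear Gaussian channel. -/
theorem lintegral_linearGaussian_sq {n : ℕ} (a : ℝ) (v : ℝ≥0) (x : Fin n → ℝ) :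
    ∫⁻ y, ∑ i, ENNReal.ofReal (y i ^ 2) ∂memoryless n (linearGaussianJamming a v) x =
      ENNReal.ofReal (a ^ 2) * ∑ i, ENNReal.ofReal (x i ^ 2) + n * v := by
  have h := lintegral_memoryless_gaussian_sq (fun x => a * x) (by fun_prop) v x 0 1
  simp only [Pi.zero_apply, zero_add, one_mul, one_pow] at h
  refine h.trans ?_
  rw [Finset.mul_sum]
  simp_rw [mul_pow, ENNReal.ofReal_add (mul_nonneg (sq_nonneg a) (sq_nonneg _)) v.coe_nonneg,
    ENNReal.ofReal_mul (sq_nonneg a)]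
  rw [Finset.sum_add_distrib]
  simp

theorem lintegral_affine_userCost {n : ℕ} (N : ℝ≥0) (C : Code ℝ ℝ ℝ ℝ n) {A : ℝ≥0∞} (hA : A ≠ ∞)
    (B : ℝ≥0∞) :
    ∫⁻ θ, ∫⁻ s, ∫⁻ x, A * ∑ i, ENNReal.ofReal (x i ^ 2) + B ∂(C.enc (θ, s))
      ∂(Measure.pi fun _ : Fin n => gaussianReal 0 1) ∂C.seed =
      A * (gaussianSystem N).expectedUserCost C + B := by
  have := C.seed_prob
  have := C.enc_markov
  simp only [lintegral_add_right _ measurable_const, lintegral_const_mul' _ _ hA,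
    lintegral_const, measure_univ, mul_one]
  rfl

/-! ### The converse for Gaussian channels -/

/-- The converse for joint source-channel coding over a Gaussian channel `Y = a X + Z`,
`Z ~ N(0, M)`, under an average power constraint. -/
theorem le_lintegral_distortion {n : ℕ} (N : ℝ≥0) (C : Code ℝ ℝ ℝ ℝ n) (a : ℝ) {P M T : ℝ≥0}
    (hM : M ≠ 0) (hT : (T : ℝ) = a ^ 2 * P + M) (hC : (gaussianSystem N).CodeFeasible P C) :
    n * ENNReal.ofReal (M / T) ≤ ∫⁻ ω, ∑ i, ENNReal.ofReal ((ω.1.1.1.2 i - ω.2 i) ^ 2)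
      ∂jointLaw C (memoryless n (linearGaussianJamming a M)) := by
  have := C.seed_prob
  have := C.enc_markov
  have := C.dec_markov
  have hM0 : (0 : ℝ) < M := by positivity
  have hT0 : (0 : ℝ) < T := by rw [hT]; positivity
  have hTne : T ≠ 0 := fun h => by simp [h] at hT0
  set μ := jointLaw C (memoryless n (linearGaussianJamming a M))
  have e1 : ∫⁻ ω, ∑ i, ENNReal.ofReal (ω.1.1.1.2 i ^ 2) ∂μ = n := by
    rw [lintegral_jointLaw _ _ (by fun_prop)]
    simp [lintegral_source_sq]
  have e2 : ∫⁻ ω, ∑ i, ENNReal.ofReal ((ω.1.2 i - a * ω.1.1.2 i) ^ 2) ∂μ = n * M := by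
    rw [lintegral_jointLaw _ _ (by fun_prop)]
    have h : ∀ x : Fin n → ℝ, ∫⁻ y, ∑ i, ENNReal.ofReal ((y i - a * x i) ^ 2)
        ∂memoryless n (linearGaussianJamming a M) x = n * M := fun x => by
      have h := lintegral_memoryless_gaussian_sq (fun x => a * x) (by fun_prop) M x
        (fun i => -(a * x i)) 1
      simp only [one_mul, neg_add_cancel] at h
      simp_rw [sub_eq_neg_add]
      refine h.trans ?_
      simp
    simp [h]
  -- The power constraint enters the converse only here.
  have e3 : ∫⁻ ω, ∑ i, ENNReal.ofReal (ω.1.2 i ^ 2) ∂μ ≤ n * T := by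
    rw [lintegral_jointLaw _ _ (by fun_prop)]
    simp only [lintegral_const, measure_univ, mul_one, lintegral_linearGaussian_sq]
    rw [lintegral_affine_userCost N C ENNReal.ofReal_ne_top]
    calc ENNReal.ofReal (a ^ 2) * (gaussianSystem N).expectedUserCost C + n * M
        ≤ ENNReal.ofReal (a ^ 2) * (n * P) + n * M := by gcongr; exact hC
      _ = n * ENNReal.ofReal T := by
          rw [hT, ENNReal.ofReal_add (by positivity) M.coe_nonneg, ENNReal.ofReal_mul (sq_nonneg a),
            ENNReal.ofReal_coe_nnreal, ENNReal.ofReal_coe_nnreal]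
          ring
      _ = n * T := by rw [ENNReal.ofReal_coe_nnreal]
  -- This is 1 + u ≤ exp u for the total exponent u, with the negative squares moved to the right so
  -- that every term lies in [0, ∞].
  have hpt : ∀ ω : (((ℝ × (Fin n → ℝ)) × (Fin n → ℝ)) × (Fin n → ℝ)) × (Fin n → ℝ),
      1 + ENNReal.ofReal (1 / 2) * ∑ i, ENNReal.ofReal (ω.1.1.1.2 i ^ 2) +
          ENNReal.ofReal (1 / (2 * M)) * ∑ i, ENNReal.ofReal ((ω.1.2 i - a * ω.1.1.2 i) ^ 2) ≤
        (∏ i, ENNReal.ofReal (Real.exp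
          ((ω.1.2 i - a * ω.1.1.2 i) ^ 2 / (2 * M) - (ω.1.2 i - 0) ^ 2 / (2 * T)))) *
        (∏ i, ENNReal.ofReal (Real.exp ((ω.1.1.1.2 i - 0) ^ 2 / (2 * (1 : ℝ≥0)) -
          (ω.1.1.1.2 i - ω.2 i) ^ 2 / (2 * (M / T : ℝ≥0))))) +
        ENNReal.ofReal (T / (2 * M)) * ∑ i, ENNReal.ofReal ((ω.1.1.1.2 i - ω.2 i) ^ 2) +
        ENNReal.ofReal (1 / (2 * T)) * ∑ i, ENNReal.ofReal (ω.1.2 i ^ 2) := by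
    rintro ⟨⟨⟨⟨θ, s⟩, x⟩, y⟩, t⟩
    dsimp only
    simp only [← ENNReal.ofReal_sum_of_nonneg fun _ _ => sq_nonneg _,
      ← ENNReal.ofReal_prod_of_nonneg fun _ _ => (Real.exp_pos _).le, ← Real.exp_sum]
    rw [← ENNReal.ofReal_mul (by positivity), ← ENNReal.ofReal_mul (by positivity),
      ← ENNReal.ofReal_mul (by positivity), ← ENNReal.ofReal_mul (by positivity),
      ← ENNReal.ofReal_mul (by positivity), ← ENNReal.ofReal_one,
      ← ENNReal.ofReal_add (by positivity) (by positivity),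
      ← ENNReal.ofReal_add (by positivity) (by positivity),
      ← ENNReal.ofReal_add (by positivity) (by positivity),
      ← ENNReal.ofReal_add (by positivity) (by positivity), ← Real.exp_add]
    refine ENNReal.ofReal_le_ofReal ?_
    refine le_trans ?_ (add_le_add (add_le_add (Real.add_one_le_exp _) le_rfl) le_rfl)
    apply le_of_eq
    simp only [Finset.mul_sum, Finset.sum_sub_distrib, sub_zero, NNReal.coe_one, mul_one,
      NNReal.coe_div]
    have h1 : ∀ i, (s i - t i) ^ 2 / (2 * (M / T : ℝ)) = T / (2 * M) * (s i - t i) ^ 2 :=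
      fun i => by field_simp
    have h2 : ∀ i, y i ^ 2 / (2 * (T : ℝ)) = 1 / (2 * T) * y i ^ 2 := fun i => by ring
    have h3 : ∀ i, (y i - a * x i) ^ 2 / (2 * (M : ℝ)) = 1 / (2 * M) * (y i - a * x i) ^ 2 :=
      fun i => by ring
    have h4 : ∀ i, s i ^ 2 / 2 = 1 / 2 * s i ^ 2 := fun i => by ring
    simp only [h1, h2, h3, h4]
    ring
  have hint := lintegral_mono (μ := μ) hpt
  rw [lintegral_add_left (by fun_prop), lintegral_add_left (by fun_prop),
    lintegral_add_left (by fun_prop), lintegral_add_left (by fun_prop),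
    lintegral_const_mul' _ _ ENNReal.ofReal_ne_top, lintegral_const_mul' _ _ ENNReal.ofReal_ne_top,
    lintegral_const_mul' _ _ ENNReal.ofReal_ne_top, lintegral_const_mul' _ _ ENNReal.ofReal_ne_top,
    lintegral_jointLaw_exp C a hM hTne, e1, e2, lintegral_const, measure_univ, mul_one] at hint
  set X := ∫⁻ ω, ∑ i, ENNReal.ofReal ((ω.1.1.1.2 i - ω.2 i) ^ 2) ∂μ
  by_cases hX : X = ∞
  · simp [hX]
  have hint2 := hint.trans (add_le_add_right
    (mul_le_mul_right e3 (ENNReal.ofReal (1 / (2 * T)))) _)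
  rw [← ENNReal.ofReal_toReal hX] at hint2 ⊢
  have hx : 0 ≤ X.toReal := ENNReal.toReal_nonneg
  rw [← ENNReal.ofReal_coe_nnreal (p := M), ← ENNReal.ofReal_coe_nnreal (p := T),
    ← ENNReal.ofReal_natCast, ← ENNReal.ofReal_one] at hint2
  rw [← ENNReal.ofReal_mul (by positivity), ← ENNReal.ofReal_mul (by positivity),
      ← ENNReal.ofReal_mul (by positivity), ← ENNReal.ofReal_mul (by positivity),
      ← ENNReal.ofReal_mul (by positivity), ← ENNReal.ofReal_mul (by positivity),
      ← ENNReal.ofReal_add (by positivity) (by positivity),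
      ← ENNReal.ofReal_add (by positivity) (by positivity),
      ← ENNReal.ofReal_add (by positivity) (by positivity),
      ← ENNReal.ofReal_add (by positivity) (by positivity),
      ENNReal.ofReal_le_ofReal_iff (by positivity)] at hint2
  rw [← ENNReal.ofReal_natCast, ← ENNReal.ofReal_mul (by positivity)]
  refine ENNReal.ofReal_le_ofReal ?_
  have h1 : 1 / (2 * (M : ℝ)) * (n * M) = n / 2 := by field_simp
  have h2 : 1 / (2 * (T : ℝ)) * (n * T) = n / 2 := by field_simp
  rw [h1, h2] at hint2
  -- The 1 from 1 + u cancels against the total mass 1, and one n/2 against the output energy.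
  have h3 : (n : ℝ) / 2 ≤ T / (2 * M) * X.toReal := by linarith
  calc (n : ℝ) * (M / T) = 2 * M / T * (n / 2) := by field_simp
    _ ≤ 2 * M / T * (T / (2 * M) * X.toReal) := by gcongr
    _ = X.toReal := by field_simp

/-! ### The two bounds on the distortion -/

theorem averageDistortion_linearGaussian {n : ℕ} (N v : ℝ≥0) (α : ℝ) (C : Code ℝ ℝ ℝ ℝ n) :
    (gaussianSystem N).averageDistortion C (iidJammer n (linearGaussianJamming α v)) =
      (n : ℝ≥0∞)⁻¹ * ∫⁻ ω, ∑ i, ENNReal.ofReal ((ω.1.1.1.2 i - ω.2 i) ^ 2)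
        ∂jointLaw C (memoryless n (linearGaussianJamming (1 + α) (v + N))) := by
  rw [lintegral_jointLaw _ _ (by fun_prop)]
  unfold System.averageDistortion
  congr 1
  refine lintegral_congr fun θ => lintegral_congr fun s => lintegral_congr fun x => ?_
  have hG : Measurable fun y => ∫⁻ t, ∑ i, ENNReal.ofReal ((s i - t i) ^ 2) ∂(C.dec (θ, y)) :=
    (Measurable.lintegral_kernel (κ := C.dec)
      (f := fun t => ∑ i, ENNReal.ofReal ((s i - t i) ^ 2)) (by fun_prop)).comp (by fun_prop)
  exact lintegral_channel_jammer N v α x hG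

theorem le_averageDistortion {n : ℕ} (hn : 0 < n) {PU N : ℝ≥0} (hN : 0 < N) (v : ℝ≥0) (α : ℝ)
    {C : Code ℝ ℝ ℝ ℝ n} (hC : (gaussianSystem N).CodeFeasible PU C) :
    ENNReal.ofReal ((v + N) / ((1 + α) ^ 2 * PU + v + N)) ≤
      (gaussianSystem N).averageDistortion C (iidJammer n (linearGaussianJamming α v)) := by
  have h := le_lintegral_distortion N C (1 + α) (P := PU) (M := v + N)
    (T := ((1 + α) ^ 2).toNNReal * PU + (v + N)) (by positivity)
    (by push_cast; rw [Real.coe_toNNReal _ (sq_nonneg _)]) hC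
  rw [averageDistortion_linearGaussian]
  have hn0 : (n : ℝ≥0∞) ≠ 0 := by simpa using hn.ne'
  refine le_trans ?_ (mul_le_mul_right h _)
  rw [← mul_assoc, ENNReal.inv_mul_cancel hn0 (ENNReal.natCast_ne_top n), one_mul]
  push_cast
  rw [Real.coe_toNNReal _ (sq_nonneg _), add_assoc]

/-- The channel noise is centred given (s, j), so it only adds c² N per letter. The rest is bounded
by source and jamming energies separately, so dependence between them or across letters is
immaterial. -/
theorem averageDistortion_uncoded_le {n : ℕ} (hn : 0 < n) {PJ N : ℝ≥0} {r c A B : ℝ}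
    (hA : 0 ≤ A) (hB : 0 ≤ B)
    (h : ∀ s j : ℝ, (s - c * (r * s + j)) ^ 2 ≤ A * s ^ 2 + B * j ^ 2) {L : Jammer ℝ ℝ n}
    (hL : (gaussianSystem N).JammerFeasible PJ (uncoded n (linearKernel r) (linearKernel c)) L) :
    (gaussianSystem N).averageDistortion (uncoded n (linearKernel r) (linearKernel c)) L ≤
      ENNReal.ofReal (A + B * PJ + c ^ 2 * N) := by
  have := L.jam_markov
  have := (gaussianSystem N).channel_markov
  have hcost : ∫⁻ s, ∫⁻ j, ∑ i, ENNReal.ofReal (j i ^ 2) ∂(L.jam fun i => r * s i)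
      ∂(Measure.pi fun _ : Fin n => gaussianReal 0 1) ≤ n * PJ := by
    refine le_trans (le_of_eq ?_) hL
    change _ = ∫⁻ θ, ∫⁻ s, ∫⁻ x, ∫⁻ j, ∑ i, ENNReal.ofReal (j i ^ 2)
      ∂(L.jam x) ∂(memoryless n (linearKernel r) s)
        ∂(Measure.pi fun _ : Fin n => gaussianReal 0 1) ∂(Measure.dirac (0 : ℝ))
    simp_rw [memoryless_linearKernel, lintegral_dirac]
  have hy : ∀ s j : Fin n → ℝ, ∫⁻ y, ∑ i, ENNReal.ofReal ((s i - c * y i) ^ 2)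
      ∂(memoryless n (gaussianSystem N).channel fun i => (r * s i, j i)) ≤
      ENNReal.ofReal A * ∑ i, ENNReal.ofReal (s i ^ 2) + n * ENNReal.ofReal (c ^ 2 * N) +
        ENNReal.ofReal B * ∑ i, ENNReal.ofReal (j i ^ 2) := fun s j => by
    have h1 := lintegral_memoryless_gaussian_sq (fun p : ℝ × ℝ => p.1 + p.2) (by fun_prop) N
      (fun i => (r * s i, j i)) s (-c)
    simp only [neg_mul, ← sub_eq_add_neg, neg_sq] at h1
    refine h1.trans_le ?_
    calc ∑ i, ENNReal.ofReal ((s i - c * (r * s i + j i)) ^ 2 + c ^ 2 * N)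
        ≤ ∑ i, (ENNReal.ofReal A * ENNReal.ofReal (s i ^ 2) + ENNReal.ofReal (c ^ 2 * N) +
            ENNReal.ofReal B * ENNReal.ofReal (j i ^ 2)) := by
          refine Finset.sum_le_sum fun i _ => ?_
          rw [← ENNReal.ofReal_mul hA, ← ENNReal.ofReal_mul hB,
            ← ENNReal.ofReal_add (by positivity) (by positivity),
            ← ENNReal.ofReal_add (by positivity) (by positivity)]
          exact ENNReal.ofReal_le_ofReal (by linarith [h (s i) (j i)])
      _ = _ := by
          rw [Finset.sum_add_distrib, Finset.sum_add_distrib, ← Finset.mul_sum, ← Finset.mul_sum]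
          simp
  have hD : (gaussianSystem N).averageDistortion (uncoded n (linearKernel r) (linearKernel c)) L =
      (n : ℝ≥0∞)⁻¹ * ∫⁻ s, ∫⁻ j, ∫⁻ y, ∑ i, ENNReal.ofReal ((s i - c * y i) ^ 2)
        ∂(memoryless n (gaussianSystem N).channel fun i => (r * s i, j i))
        ∂(L.jam fun i => r * s i) ∂(Measure.pi fun _ : Fin n => gaussianReal 0 1) := by
    change (n : ℝ≥0∞)⁻¹ * ∫⁻ θ, ∫⁻ s, ∫⁻ x, ∫⁻ j, ∫⁻ y, ∫⁻ t,
        ∑ i, ENNReal.ofReal ((s i - t i) ^ 2) ∂(memoryless n (linearKernel c) y)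
        ∂(memoryless n (gaussianSystem N).channel fun i => (x i, j i)) ∂(L.jam x)
        ∂(memoryless n (linearKernel r) s)
        ∂(Measure.pi fun _ : Fin n => gaussianReal 0 1) ∂(Measure.dirac (0 : ℝ)) = _
    simp_rw [memoryless_linearKernel, lintegral_dirac]
  have hn0 : (n : ℝ≥0∞) ≠ 0 := by simpa using hn.ne'
  rw [hD]
  calc _ ≤ (n : ℝ≥0∞)⁻¹ * ∫⁻ s, ∫⁻ j, (ENNReal.ofReal A * ∑ i, ENNReal.ofReal (s i ^ 2) +
          n * ENNReal.ofReal (c ^ 2 * N) + ENNReal.ofReal B * ∑ i, ENNReal.ofReal (j i ^ 2))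
        ∂(L.jam fun i => r * s i) ∂(Measure.pi fun _ : Fin n => gaussianReal 0 1) := by
        gcongr with s j
        exact hy s j
    _ = (n : ℝ≥0∞)⁻¹ * (ENNReal.ofReal A * n + n * ENNReal.ofReal (c ^ 2 * N) +
          ENNReal.ofReal B * ∫⁻ s, ∫⁻ j, ∑ i, ENNReal.ofReal (j i ^ 2) ∂(L.jam fun i => r * s i)
            ∂(Measure.pi fun _ : Fin n => gaussianReal 0 1)) := by
        simp only [lintegral_add_left measurable_const, lintegral_const, measure_univ, mul_one,
          lintegral_const_mul' _ _ ENNReal.ofReal_ne_top]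
        rw [lintegral_add_left (by fun_prop), lintegral_add_left (by fun_prop),
          lintegral_const_mul' _ _ ENNReal.ofReal_ne_top,
          lintegral_const_mul' _ _ ENNReal.ofReal_ne_top, lintegral_source_sq, lintegral_const,
          measure_univ, mul_one]
    _ ≤ (n : ℝ≥0∞)⁻¹ * (ENNReal.ofReal A * n + n * ENNReal.ofReal (c ^ 2 * N) +
          ENNReal.ofReal B * (n * PJ)) := by gcongr
    _ = (n : ℝ≥0∞)⁻¹ * n * ENNReal.ofReal (A + B * PJ + c ^ 2 * N) := by
        rw [ENNReal.ofReal_add (by positivity) (by positivity),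
          ENNReal.ofReal_add (by positivity) (by positivity), ENNReal.ofReal_mul hB,
          ENNReal.ofReal_coe_nnreal]
        ring
    _ = _ := by rw [ENNReal.inv_mul_cancel hn0 (ENNReal.natCast_ne_top n), one_mul]

/-! ### Feasibility and the equilibrium -/

theorem codeFeasible_uncoded (n : ℕ) (PU N : ℝ≥0) (c : ℝ) :
    (gaussianSystem N).CodeFeasible PU (uncoded n (linearKernel √(PU : ℝ)) (linearKernel c)) := by
  change ∫⁻ θ, ∫⁻ s, ∫⁻ x, ∑ i, ENNReal.ofReal (x i ^ 2) ∂(memoryless n (linearKernel √(PU : ℝ)) s)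
    ∂(Measure.pi fun _ : Fin n => gaussianReal 0 1) ∂(Measure.dirac (0 : ℝ)) ≤ n * PU
  simp_rw [memoryless_linearKernel, lintegral_dirac, mul_pow, Real.sq_sqrt PU.coe_nonneg,
    ENNReal.ofReal_mul PU.coe_nonneg, ← Finset.mul_sum]
  rw [lintegral_const_mul' _ _ ENNReal.ofReal_ne_top, lintegral_source_sq,
    ENNReal.ofReal_coe_nnreal, mul_comm]

/-- The expected jamming energy is α² times the user's energy plus n v, so the code matters only
through its power. -/
theorem jammerFeasible_linearGaussian {n : ℕ} {PU PJ N v : ℝ≥0} {α : ℝ}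
    (h : α ^ 2 * PU + v ≤ (PJ : ℝ)) {C : Code ℝ ℝ ℝ ℝ n}
    (hC : (gaussianSystem N).CodeFeasible PU C) :
    (gaussianSystem N).JammerFeasible PJ C (iidJammer n (linearGaussianJamming α v)) := by
  change ∫⁻ θ, ∫⁻ s, ∫⁻ x, ∫⁻ j, ∑ i, ENNReal.ofReal (j i ^ 2)
    ∂(memoryless n (linearGaussianJamming α v) x) ∂(C.enc (θ, s))
    ∂(Measure.pi fun _ : Fin n => gaussianReal 0 1) ∂C.seed ≤ n * PJ
  simp_rw [lintegral_linearGaussian_sq]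
  rw [lintegral_affine_userCost N C ENNReal.ofReal_ne_top]
  calc ENNReal.ofReal (α ^ 2) * (gaussianSystem N).expectedUserCost C + n * v
      ≤ ENNReal.ofReal (α ^ 2) * (n * PU) + n * v := by gcongr; exact hC
    _ = n * ENNReal.ofReal (α ^ 2 * PU + v) := by
        rw [ENNReal.ofReal_add (by positivity) v.coe_nonneg, ENNReal.ofReal_mul (sq_nonneg α),
          ENNReal.ofReal_coe_nnreal, ENNReal.ofReal_coe_nnreal]
        ring
    _ ≤ n * ENNReal.ofReal PJ := by gcongr
    _ = n * PJ := by rw [ENNReal.ofReal_coe_nnreal]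

theorem IsBasarParameters.isNash {PU PJ N v : ℝ≥0} {α : ℝ} (hPU : 0 < PU) (hN : 0 < N)
    (h : IsBasarParameters PU PJ N α v) {n : ℕ} (hn : 0 < n) :
    (gaussianSystem N).IsNash PU PJ
      (uncoded n (linearKernel √(PU : ℝ)) (linearKernel (bayesGain PU N α v)))
      (iidJammer n (linearGaussianJamming α v)) := by
  have hupper : ∀ L : Jammer ℝ ℝ n, (gaussianSystem N).JammerFeasible PJ
      (uncoded n (linearKernel √(PU : ℝ)) (linearKernel (bayesGain PU N α v))) L →
      (gaussianSystem N).averageDistortion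
        (uncoded n (linearKernel √(PU : ℝ)) (linearKernel (bayesGain PU N α v))) L ≤
      ENNReal.ofReal ((v + N) / ((1 + α) ^ 2 * PU + v + N)) := fun L hL => by
    refine ENNReal.le_of_forall_pos_le_add fun ε hε _ => ?_
    obtain ⟨A, B, hA, hB, hAB, hle⟩ := h.exists_weights hPU hN (ε := (ε : ℝ)) (NNReal.coe_pos.2 hε)
    refine (averageDistortion_uncoded_le hn hA hB hAB hL).trans
      ((ENNReal.ofReal_le_ofReal hle).trans ?_)
    rw [ENNReal.ofReal_add (by positivity) ε.coe_nonneg, ENNReal.ofReal_coe_nnreal]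
  have hC := codeFeasible_uncoded n PU N (bayesGain PU N α v)
  have hJ := fun (C : Code ℝ ℝ ℝ ℝ n) (hC : (gaussianSystem N).CodeFeasible PU C) =>
    jammerFeasible_linearGaussian (h.power_le hPU) hC
  -- Either optimality passes through V: the upper bound for the jammer on the left, then the
  -- converse for the code on the right.
  exact ⟨hC, hJ, fun L' hL' => (hupper L' hL').trans (le_averageDistortion hn hN v α hC),
    fun C' hC' => (hupper _ (hJ _ hC)).trans (le_averageDistortion hn hN v α hC')⟩

/-- The regions are exhaustive, and the inequality defining the second is exactly nonnegativity of
its noise variance. -/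
theorem exists_isBasarParameters {PU : ℝ≥0} (hPU : 0 < PU) (PJ N : ℝ≥0) :
    ∃ α v, IsBasarParameters PU PJ N α v := by
  have hP : (0 : ℝ) < PU := hPU
  rcases le_or_gt PU PJ with h | h
  · exact ⟨-1, 0, Or.inl ⟨h, rfl, by simpa using h⟩⟩
  rcases le_or_gt ((PJ + N) ^ 2) (PU * PJ) with h' | h'
  · have h2 : (PJ + N : ℝ) ^ 2 ≤ PU * PJ := by exact_mod_cast h'
    have h3 : 0 ≤ PJ - (PJ + N : ℝ) ^ 2 / PU := by
      rw [sub_nonneg, div_le_iff₀ hP]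
      linarith
    exact ⟨_, ⟨_, h3⟩, Or.inr (Or.inl ⟨h, h', rfl, rfl⟩)⟩
  · exact ⟨_, 0, Or.inr (Or.inr ⟨h, h', rfl, rfl⟩)⟩

end JSCCSJ

theorem mainTheorem5 (PU PJ N : ℝ≥0) (hPU : 0 < PU) (hN : 0 < N) :
    (JSCCSJ.gaussianSystem N).IsMatched PU PJ ∧
    ∀ (α : ℝ) (v : ℝ≥0), JSCCSJ.IsBasarParameters PU PJ N α v → ∀ n : ℕ, 0 < n →
      (JSCCSJ.gaussianSystem N).IsNash PU PJ
        (JSCCSJ.uncoded n (JSCCSJ.linearKernel √(PU : ℝ))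
          (JSCCSJ.linearKernel (JSCCSJ.bayesGain PU N α v)))
        (JSCCSJ.iidJammer n (JSCCSJ.linearGaussianJamming α v)) := by
  refine ⟨?_, fun α v h n hn => h.isNash hPU hN hn⟩
  obtain ⟨α, v, h⟩ := JSCCSJ.exists_isBasarParameters hPU PJ N
  exact ⟨_, inferInstance, _, inferInstance, _, inferInstance, fun n hn => h.isNash hPU hN hn⟩
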